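/- Let $P\subset\mathbb{R}^3$ be a convex polytope, that is, the convex hull of a finite set of points, with non-empty interior. For $0\le k\le 2$ let $f_k(P)$ be the number of $k$-dimensional faces of $P$. For a point $v\in P$ let $\alpha_P(v)$ be the surface area measure of the set $\{u\in\mathbb{S}^2 : v+\epsilon u\in P \text{ for some } \epsilon>0\}$ on the unit sphere $\mathbb{S}^2\subset\mathbb{R}^3$, and for a face $F$ of $P$ with centroid $\hat F$ put $\alpha_P(F)=\alpha_P(\hat F)$. Then $$\frac{1}{2\pi}\sum_{v}\alpha_P(v)\;-\;\frac{1}{2\pi}\sum_{e}\alpha_P(e)\;=\;f_0(P)-f_1(P)\;=\;2-f_2(P),$$ where the first sum runs over the vertices $v$ of $P$ and the second over the edges ($1$-dimensional faces) $e$ of $P$. -/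

import Mathlib

open MeasureTheory

noncomputable section

namespace PolytopeAngle

/-- A convex polytope in `ℝⁿ`: the convex hull of a finite set of points. -/
def IsConvexPolytope {n : ℕ} (P : Set (EuclideanSpace ℝ (Fin n))) : Prop :=
  ∃ S : Set (EuclideanSpace ℝ (Fin n)), S.Finite ∧ P = convexHull ℝ S

/-- The dimension of a set, that is, the dimension of its affine hull
(used for non-empty sets only). -/
def affDim {n : ℕ} (F : Set (EuclideanSpace ℝ (Fin n))) : ℕ :=
  Module.finrank ℝ (vectorSpan ℝ F)

/-- The `k`-dimensional faces of `P`: the non-empty sets of dimension `k` on which some linear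
functional attains its maximum over `P`. -/
def faces {n : ℕ} (k : ℕ) (P : Set (EuclideanSpace ℝ (Fin n))) :
    Set (Set (EuclideanSpace ℝ (Fin n))) :=
  {F | F.Nonempty ∧ IsExposed ℝ P F ∧ affDim F = k}

/-- The vertices of `P`: the points `v` such that `{v}` is a `0`-dimensional face. -/
def vertices {n : ℕ} (P : Set (EuclideanSpace ℝ (Fin n))) : Set (EuclideanSpace ℝ (Fin n)) :=
  {v | {v} ∈ faces 0 P}

/-- The number `f_k(P)` of `k`-dimensional faces of `P`. -/
def faceCount {n : ℕ} (k : ℕ) (P : Set (EuclideanSpace ℝ (Fin n))) : ℕ :=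
  (faces k P).ncard

/-- The solid inner angle `a_P(v)`: the unit vectors pointing from `v` into `P`. -/
def solidAngle {n : ℕ} (P : Set (EuclideanSpace ℝ (Fin n))) (v : EuclideanSpace ℝ (Fin n)) :
    Set (Metric.sphere (0 : EuclideanSpace ℝ (Fin n)) 1) :=
  {u | ∃ ε : ℝ, 0 < ε ∧ v + ε • (u : EuclideanSpace ℝ (Fin n)) ∈ P}

/-- The measure `α_P(v)` of the solid inner angle at the point `v`, with respect to the surface
area measure on the unit sphere (of total mass `n ω_n`). -/
def angleAt {n : ℕ} (P : Set (EuclideanSpace ℝ (Fin n))) (v : EuclideanSpace ℝ (Fin n)) : ℝ :=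
  (volume : Measure (EuclideanSpace ℝ (Fin n))).toSphere.real (solidAngle P v)

/-- The centroid of `F`: the mean of its points with respect to Hausdorff measure in the dimension
of `F` (the normalization of that measure does not matter for a mean). -/
def centroid {n : ℕ} (F : Set (EuclideanSpace ℝ (Fin n))) : EuclideanSpace ℝ (Fin n) :=
  ⨍ x in F, x ∂(Measure.hausdorffMeasure (affDim F : ℝ))

/-- The measure `α_P(F)` of the solid inner angle of `P` at its face `F`: the one at the centroid
of `F`. -/
def faceAngle {n : ℕ} (P F : Set (EuclideanSpace ℝ (Fin n))) : ℝ :=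
  angleAt P (centroid F)

/-- A convex polytope has finitely many `k`-dimensional faces, so that `faceCount` and the sums
over faces have their usual meaning. -/
theorem faces_finite {n : ℕ} (k : ℕ) {P : Set (EuclideanSpace ℝ (Fin n))}
    (hP : IsConvexPolytope P) : (faces k P).Finite := by
  obtain ⟨S, hS, rfl⟩ := hP
  have hc : IsCompact (convexHull ℝ S) := hS.isCompact_convexHull (𝕜 := ℝ)
  have key : ∀ F ∈ faces k (convexHull ℝ S),
      F.extremePoints ℝ ⊆ S ∧ closure (convexHull ℝ (F.extremePoints ℝ)) = F := by
    rintro F ⟨_, hF, _⟩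
    refine ⟨fun x hx => extremePoints_convexHull_subset
      (hF.isExtreme.extremePoints_subset_extremePoints hx), ?_⟩
    exact closure_convexHull_extremePoints (hF.isCompact hc) (hF.convex (convex_convexHull ℝ S))
  refine Set.Finite.subset
    (hS.finite_subsets.image fun T => closure (convexHull ℝ T)) ?_
  intro F hF
  exact ⟨F.extremePoints ℝ, (key F hF).1, (key F hF).2⟩

/-- A convex polytope has finitely many vertices. -/
theorem vertices_finite {n : ℕ} {P : Set (EuclideanSpace ℝ (Fin n))}
    (hP : IsConvexPolytope P) : (vertices P).Finite :=
  (faces_finite 0 hP).preimage Set.singleton_injective.injOn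

end PolytopeAngle

end

/-! Gram's relation, the alternating sum over all faces (including `P`) of the solid angles, equals
zero. In dimension three a facet contributes `2π` and `P` itself `4π`, so vertex angles minus edge
angles equal `2π (2 - f₂)`, and Euler's relation turns this into `2π (f₀ - f₁)`.

Both relations come from one counting principle, `EulerSliceable.sum_eulerSign`: if a suitable set
is cut into finitely many relatively open convex pieces, the signs `(-1) ^ dim` of the pieces add up
to 1. It is proved by sweeping with a linear functional and counting jumps of the fibre sums.
Applied to `P`, the disjoint union of the relative interiors of its faces, it gives Euler's
relation.

For a direction `u`, it applies also to the points of `P` that cannot be moved inside `P` along `u`: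
this set is a section of the projection of `P` along `u`, and a union of relative interiors of
faces. Subtracting, the signs of the faces at which `u` points into `P` sum to 0. Integrating over
the sphere gives Gram's relation. -/

namespace PolytopeAngle

open MeasureTheory Set Filter Topology

/-! ### Relative interiors and relatively open convex sets -/

section RelInt

variable {E : Type*} [AddCommGroup E] [Module ℝ E]

/-- The algebraic relative interior of `F`: the points of `F` at which every segment of `F`
ending there can be prolonged inside `F`. -/
def relInt (F : Set E) : Set E :=
  {x | x ∈ F ∧ ∀ y ∈ F, ∃ ε : ℝ, 0 < ε ∧ x + ε • (x - y) ∈ F}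

/-- A convex set that is open in its affine hull. -/
def IsRelOpen (K : Set E) : Prop := Convex ℝ K ∧ K ⊆ relInt K

theorem exists_add_smul_mem {F : Set E} (hF : Convex ℝ F) {x : E} (hx : x ∈ relInt F) {v : E}
    (hv : v ∈ vectorSpan ℝ F) : ∃ ε : ℝ, 0 < ε ∧ x + ε • v ∈ F := by
  -- Quantifying over all real multiples, negative ones included, makes the claim stable under
  -- scalar multiplication in the span induction.
  suffices h : ∀ c : ℝ, ∃ ε : ℝ, 0 < ε ∧ x + ε • (c • v) ∈ F by simpa using h 1
  rw [vectorSpan_eq_span_vsub_set_right ℝ hx.1] at hv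
  induction hv using Submodule.span_induction with
  | mem v hv =>
    obtain ⟨y, hy, rfl⟩ := hv
    intro c
    simp only [vsub_eq_sub]
    rcases lt_trichotomy c 0 with hc | rfl | hc
    · obtain ⟨ε, hε, h⟩ := hx.2 y hy
      refine ⟨ε / (-c), div_pos hε (neg_pos.2 hc), ?_⟩
      convert h using 2
      rw [smul_smul, div_mul_eq_mul_div, div_neg, mul_div_assoc, div_self hc.ne]
      module
    · exact ⟨1, one_pos, by simpa using hx.1⟩
    · refine ⟨1 / c, by positivity, ?_⟩
      rw [smul_smul, one_div_mul_cancel hc.ne']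
      simpa using hy
  | zero => exact fun c => ⟨1, one_pos, by simpa using hx.1⟩
  | add v w _ _ hv hw =>
    intro c
    obtain ⟨a, ha, hav⟩ := hv c
    obtain ⟨b, hb, hbw⟩ := hw c
    refine ⟨a * b / (a + b), by positivity, ?_⟩
    convert hF hav hbw (a := b / (a + b)) (b := a / (a + b)) (by positivity) (by positivity)
      (by field_simp; ring) using 1
    match_scalars <;> field_simp
    ring
  | smul a v _ hv => exact fun c => by simpa [smul_smul] using hv (c * a)

theorem add_smul_mem_relInt {F : Set E} (hF : Convex ℝ F) {x y : E} (hx : x ∈ relInt F)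
    (hy : y ∈ F) {t : ℝ} (h0 : 0 ≤ t) (h1 : t < 1) : x + t • (y - x) ∈ relInt F := by
  refine ⟨hF.add_smul_sub_mem hx.1 hy ⟨h0, h1.le⟩, fun w hw => ?_⟩
  obtain ⟨ε, hε, h⟩ := hx.2 w hw
  have ht : 0 < 1 - t := by linarith
  refine ⟨(1 - t) * ε / (1 + ε), by positivity, ?_⟩
  set δ := (1 - t) * ε / (1 + ε) with hδ
  have hδ0 : 0 < δ := by positivity
  -- With `z = x + t • (y - x)`, expand `z + δ • (z - w)` and write `x` through `x + ε • (x - w)`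
  -- and `w`. The weight of `w` is `(1 + δ) (1 - t) ε / (1 + ε) - δ`, which this `δ` makes equal to
  -- `δ ^ 2 ≥ 0`.
  have key := hF.sum_mem (t := Finset.univ)
    (w := ![(1 + δ) * (1 - t) / (1 + ε), δ ^ 2, (1 + δ) * t])
    (z := ![x + ε • (x - w), w, y])
    (by intro i _; fin_cases i <;> simp <;> positivity)
    (by
      simp [Fin.sum_univ_three]
      rw [hδ]; field_simp; ring)
    (by intro i _; fin_cases i <;> simp [h, hw, hy])
  convert key using 1
  simp only [Fin.sum_univ_three, Matrix.cons_val_zero, Matrix.cons_val_one, Matrix.cons_val]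
  rw [hδ]
  match_scalars <;> field_simp <;> ring

theorem isRelOpen_relInt {F : Set E} (hF : Convex ℝ F) : IsRelOpen (relInt F) := by
  refine ⟨?_, fun x hx => ⟨hx, fun y hy => ?_⟩⟩
  · rw [convex_iff_forall_pos]
    intro x hx y hy a b ha hb hab
    have := add_smul_mem_relInt hF hx hy.1 hb.le (by linarith)
    convert this using 1
    rw [← eq_sub_iff_add_eq] at hab
    subst hab
    module
  · obtain ⟨ε, hε, h⟩ := hx.2 y hy.1
    refine ⟨ε / 2, by positivity, ?_⟩
    have := add_smul_mem_relInt hF hx h (t := 1 / 2) (by norm_num) (by norm_num)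
    convert this using 1
    module

theorem vectorSpan_relInt {F : Set E} (hF : Convex ℝ F) (hne : (relInt F).Nonempty) :
    vectorSpan ℝ (relInt F) = vectorSpan ℝ F := by
  obtain ⟨x, hx⟩ := hne
  refine le_antisymm (vectorSpan_mono ℝ fun y hy => hy.1) ?_
  rw [vectorSpan_eq_span_vsub_set_right ℝ hx.1, Submodule.span_le]
  rintro _ ⟨y, hy, rfl⟩
  have h := add_smul_mem_relInt hF hx hy (t := 1 / 2) (by norm_num) (by norm_num)
  have := (vectorSpan ℝ (relInt F)).smul_mem 2 (vsub_mem_vectorSpan ℝ h hx)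
  simpa [smul_smul] using this

theorem IsRelOpen.inter_fiber {K : Set E} (hK : IsRelOpen K) (l : E →ₗ[ℝ] ℝ) (t : ℝ) :
    IsRelOpen (K ∩ {x | l x = t}) := by
  refine ⟨hK.1.inter ?_, ?_⟩
  · exact (convex_singleton t).linear_preimage l
  · rintro x ⟨hx, hxt⟩
    refine ⟨⟨hx, hxt⟩, fun y hy => ?_⟩
    obtain ⟨ε, hε, h⟩ := (hK.2 hx).2 y hy.1
    refine ⟨ε, hε, h, ?_⟩
    have h1 : l x = t := hxt
    have h2 : l y = t := hy.2
    simp [h1, h2]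

/-- Relative openness lets a direction of `K` in the kernel of `l` be followed a little from any
point of the fibre, and such a move stays in the fibre. -/
theorem IsRelOpen.vectorSpan_inter_fiber {K : Set E} (hK : IsRelOpen K) (l : E →ₗ[ℝ] ℝ) {t : ℝ}
    (hne : (K ∩ {x | l x = t}).Nonempty) :
    vectorSpan ℝ (K ∩ {x | l x = t}) = vectorSpan ℝ K ⊓ LinearMap.ker l := by
  obtain ⟨x, hx, hxt⟩ := hne
  have hxt' : l x = t := hxt
  refine le_antisymm (le_inf (vectorSpan_mono ℝ inter_subset_left) ?_) ?_
  · rw [vectorSpan_eq_span_vsub_set_right ℝ (show x ∈ K ∩ {x | l x = t} from ⟨hx, hxt⟩),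
      Submodule.span_le]
    rintro _ ⟨y, hy, rfl⟩
    have h2 : l y = t := hy.2
    simp [hxt', h2]
  · rintro v ⟨hv, hvl⟩
    have hvl' : l v = 0 := hvl
    obtain ⟨ε, hε, h⟩ := exists_add_smul_mem hK.1 (hK.2 hx) hv
    have h' : x + ε • v ∈ K ∩ {x | l x = t} := ⟨h, by simp [hxt', hvl']⟩
    have := (vectorSpan ℝ (K ∩ {x | l x = t})).smul_mem ε⁻¹
      (vsub_mem_vectorSpan ℝ h' (show x ∈ K ∩ {x | l x = t} from ⟨hx, hxt⟩))
    simpa [smul_smul, hε.ne'] using this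

open Classical in
/-- The Euler characteristic of a bounded relatively open convex set: `(-1) ^ dim K`,
and `0` for the empty set. -/
noncomputable def eulerSign (K : Set E) : ℤ :=
  if K.Nonempty then (-1) ^ Module.finrank ℝ (vectorSpan ℝ K) else 0

theorem eulerSign_of_nonempty {K : Set E} (hK : K.Nonempty) :
    eulerSign K = (-1) ^ Module.finrank ℝ (vectorSpan ℝ K) := if_pos hK

@[simp] theorem eulerSign_empty : eulerSign (∅ : Set E) = 0 := by simp [eulerSign]

end RelInt

/-! ### The Euler characteristic by sweeping with a functional -/

section Valuation

variable {E : Type*} [AddCommGroup E] [Module ℝ E]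

theorem finrank_inf_ker_add_one [FiniteDimensional ℝ E] (W : Submodule ℝ E) (l : E →ₗ[ℝ] ℝ)
    (h : ¬ W ≤ LinearMap.ker l) :
    Module.finrank ℝ ↥(W ⊓ LinearMap.ker l) + 1 = Module.finrank ℝ W := by
  have h0 : l.domRestrict W ≠ 0 := by
    intro h0
    exact h fun w hw => by simpa using LinearMap.congr_fun h0 ⟨w, hw⟩
  have h1 := Module.Dual.finrank_ker_add_one_of_ne_zero h0
  rw [← h1, LinearMap.ker_domRestrict]
  congr 1
  rw [← Submodule.map_comap_subtype, Submodule.finrank_map_subtype_eq]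

/-- If `l` is constant on `K`, the only non-empty fibre is `K` itself. Otherwise `l '' K` is an open
interval over which the fibres have dimension one less, hence sign `-eulerSign K`. Comparing a value
with those just to its right detects only the left endpoint: at the right endpoint both fibres are
empty. -/
theorem IsRelOpen.eulerSign_fiber_jump [FiniteDimensional ℝ E] {K : Set E} (hK : IsRelOpen K)
    (l : E →ₗ[ℝ] ℝ) {α β : ℝ} (hb : l '' K ⊆ Icc α β) :
    ∃ p : ℝ, ∀ t, ∀ᶠ t' in 𝓝[>] t,
      eulerSign (K ∩ {x | l x = t}) - eulerSign (K ∩ {x | l x = t'}) =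
        if p = t then eulerSign K else 0 := by
  rcases K.eq_empty_or_nonempty with rfl | hne
  · exact ⟨0, fun t => by simp⟩
  have hempty : ∀ t, t ∉ l '' K → eulerSign (K ∩ {x | l x = t}) = 0 := by
    intro t ht
    rw [show K ∩ {x | l x = t} = ∅ from ?_, eulerSign_empty]
    rw [eq_empty_iff_forall_notMem]
    exact fun x hx => ht ⟨x, hx.1, hx.2⟩
  have hnon : ∀ t, t ∈ l '' K → eulerSign (K ∩ {x | l x = t}) =
      (-1) ^ Module.finrank ℝ ↥(vectorSpan ℝ K ⊓ LinearMap.ker l) := by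
    rintro t ⟨x, hx, hxt⟩
    have : (K ∩ {x | l x = t}).Nonempty := ⟨x, hx, hxt⟩
    rw [eulerSign_of_nonempty this, hK.vectorSpan_inter_fiber l this]
  obtain ⟨x₀, hx₀⟩ := hne
  by_cases hc : vectorSpan ℝ K ≤ LinearMap.ker l
  · rw [inf_eq_left.2 hc, ← eulerSign_of_nonempty ⟨x₀, hx₀⟩] at hnon
    have himg : ∀ t, t ∈ l '' K → t = l x₀ := by
      rintro _ ⟨y, hy, rfl⟩
      have := hc (vsub_mem_vectorSpan ℝ hy hx₀)
      simpa [sub_eq_zero] using this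
    refine ⟨l x₀, fun t => ?_⟩
    split_ifs with h
    · subst h
      filter_upwards [self_mem_nhdsWithin] with t' ht'
      rw [hnon _ ⟨x₀, hx₀, rfl⟩, hempty t' fun h => (ne_of_gt ht') (himg _ h), sub_zero]
    · have h1 : t ∉ l '' K := fun h' => h (himg _ h').symm
      have h2 : ∀ᶠ t' in 𝓝[>] t, t' ≠ l x₀ :=
        nhdsWithin_le_nhds (isOpen_ne.mem_nhds (Ne.symm h))
      filter_upwards [h2] with t' ht'
      rw [hempty _ h1, hempty t' fun h => ht' (himg _ h), sub_zero]
  · have hdim := finrank_inf_ker_add_one _ l hc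
    have hsign : eulerSign K =
        -(-1) ^ Module.finrank ℝ ↥(vectorSpan ℝ K ⊓ LinearMap.ker l) := by
      rw [eulerSign_of_nonempty ⟨x₀, hx₀⟩, ← hdim, pow_succ]; ring
    have hbd : BddBelow (l '' K) := bddBelow_Icc.mono hb
    have hba : BddAbove (l '' K) := bddAbove_Icc.mono hb
    have hconv : Convex ℝ (l '' K) := hK.1.linear_image l
    obtain ⟨v, hv, hvl⟩ : ∃ v ∈ vectorSpan ℝ K, l v < 0 := by
      obtain ⟨v, hv, hvl⟩ := SetLike.not_le_iff_exists.1 hc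
      rcases lt_or_gt_of_ne (show l v ≠ 0 from hvl) with h | h
      · exact ⟨v, hv, h⟩
      · exact ⟨-v, neg_mem hv, by simpa using h⟩
    -- From any point of `K` one can move along both `v` and `-v`, so neither extreme value is
    -- attained.
    have hIoo : l '' K = Ioo (sInf (l '' K)) (sSup (l '' K)) := by
      apply Subset.antisymm
      · rintro _ ⟨x, hx, rfl⟩
        constructor
        · obtain ⟨ε, hε, h⟩ := exists_add_smul_mem hK.1 (hK.2 hx) hv
          refine (csInf_le hbd ⟨_, h, rfl⟩).trans_lt ?_
          simpa using mul_neg_of_pos_of_neg hε hvl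
        · obtain ⟨ε, hε, h⟩ := exists_add_smul_mem hK.1 (hK.2 hx) (neg_mem hv)
          refine lt_of_lt_of_le ?_ (le_csSup hba ⟨_, h, rfl⟩)
          simpa using mul_neg_of_pos_of_neg hε hvl
      · exact IsConnected.Ioo_csInf_csSup_subset ⟨⟨_, mem_image_of_mem l hx₀⟩, hconv.isPreconnected⟩ hbd hba
    set p := sInf (l '' K)
    set q := sSup (l '' K)
    have hpq : p < q := by
      have : l x₀ ∈ Ioo p q := hIoo ▸ mem_image_of_mem l hx₀
      exact this.1.trans this.2
    have hin : ∀ t, p < t → t < q → eulerSign (K ∩ {x | l x = t}) = -eulerSign K :=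
      fun t h1 h2 => by rw [hnon t (hIoo ▸ ⟨h1, h2⟩), hsign, neg_neg]
    refine ⟨p, fun t => ?_⟩
    rcases lt_trichotomy t p with h | rfl | h
    · rw [if_neg h.ne']
      filter_upwards [Ioo_mem_nhdsGT h] with t' ht'
      rw [hempty t (by rw [hIoo]; exact fun h' => lt_asymm h h'.1),
        hempty t' (by rw [hIoo]; exact fun h' => lt_asymm ht'.2 h'.1), sub_zero]
    · rw [if_pos rfl]
      filter_upwards [Ioo_mem_nhdsGT hpq] with t' ht'
      rw [hempty p (by rw [hIoo]; exact fun h' => lt_irrefl _ h'.1), hin t' ht'.1 ht'.2]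
      ring
    · rw [if_neg h.ne]
      rcases lt_or_ge t q with hq | hq
      · filter_upwards [Ioo_mem_nhdsGT hq] with t' ht'
        rw [hin t h hq, hin t' (h.trans ht'.1) ht'.2, sub_self]
      · filter_upwards [self_mem_nhdsWithin] with t' ht'
        have ht'' : t < t' := ht'
        rw [hempty t (by rw [hIoo]; exact fun h' => not_lt_of_ge hq h'.2),
          hempty t' (by rw [hIoo]; exact fun h' => not_lt_of_ge (hq.trans ht''.le) h'.2), sub_zero]

/-- Sets that reduce to points by successively passing to the fibres of linear functionals whose
values on the set fill a compact interval. -/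
inductive EulerSliceable : Set E → Prop
  | subsingleton {X : Set E} (h : X.Subsingleton) : EulerSliceable X
  | slice {X : Set E} (l : E →ₗ[ℝ] ℝ) (α β : ℝ) (himg : l '' X = Icc α β)
      (hfib : ∀ t, EulerSliceable (X ∩ {x | l x = t})) : EulerSliceable X

theorem sum_eulerSign_subsingleton {X : Set E} (hX : X.Subsingleton) (hne : X.Nonempty)
    {ι : Type*} (s : Finset ι) (K : ι → Set E)
    (hdisj : (s : Set ι).PairwiseDisjoint K) (hU : X = ⋃ i ∈ s, K i) :
    ∑ i ∈ s, eulerSign (K i) = 1 := by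
  obtain ⟨x, hx⟩ := hne
  have hsub : ∀ i ∈ s, K i ⊆ X := fun i hi => hU ▸ subset_biUnion_of_mem (u := K) hi
  have hx' := hx
  rw [hU] at hx'
  obtain ⟨i, hi, hxi⟩ := mem_iUnion₂.1 hx'
  rw [Finset.sum_eq_single_of_mem i hi]
  · have : K i = {x} := (hX.anti (hsub i hi)).eq_singleton_of_mem hxi
    rw [eulerSign_of_nonempty ⟨x, hxi⟩, this, vectorSpan_singleton, finrank_bot, pow_zero]
  · intro j hj hji
    rcases (K j).eq_empty_or_nonempty with h | ⟨y, hy⟩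
    · rw [h, eulerSign_empty]
    · exact absurd hxi (disjoint_left.1 (hdisj hj hi hji) (hX (hsub j hj hy) hx ▸ hy))

/-- By induction the fibre sums form the indicator function of `[α, β]`, whose only drop to the
right is 1, at `β`. Each piece contributes its own sign as a drop at a single value `p i`, so the
signs total 1. -/
theorem EulerSliceable.sum_eulerSign [FiniteDimensional ℝ E] {X : Set E} (hX : EulerSliceable X)
    (hne : X.Nonempty) {ι : Type*} (s : Finset ι) (K : ι → Set E) (hK : ∀ i ∈ s, IsRelOpen (K i))
    (hdisj : (s : Set ι).PairwiseDisjoint K) (hU : X = ⋃ i ∈ s, K i) :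
    ∑ i ∈ s, eulerSign (K i) = 1 := by
  induction hX generalizing K with
  | subsingleton h => exact sum_eulerSign_subsingleton h hne s K hdisj hU
  | @slice X l α β himg hfib ih =>
    have hαβ : α ≤ β := by
      rw [← nonempty_Icc, ← himg]
      exact hne.image l
    have hsub : ∀ i ∈ s, K i ⊆ X := fun i hi => hU ▸ subset_biUnion_of_mem (u := K) hi
    have hg1 : ∀ t ∈ Icc α β, ∑ i ∈ s, eulerSign (K i ∩ {x | l x = t}) = 1 := by
      intro t ht
      rw [← himg] at ht
      obtain ⟨x, hx, hxt⟩ := ht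
      refine ih t ⟨x, hx, hxt⟩ _ (fun i hi => (hK i hi).inter_fiber l t) ?_ ?_
      · exact hdisj.mono fun i => inter_subset_left
      · rw [hU]
        simp only [iUnion_inter]
    have hg0 : ∀ t, t ∉ Icc α β → ∑ i ∈ s, eulerSign (K i ∩ {x | l x = t}) = 0 := by
      intro t ht
      refine Finset.sum_eq_zero fun i hi => ?_
      rw [show K i ∩ {x | l x = t} = ∅ from ?_, eulerSign_empty]
      rw [eq_empty_iff_forall_notMem]
      exact fun x hx => ht (himg ▸ ⟨x, hsub i hi hx.1, hx.2⟩)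
    have hjump : ∀ i, ∃ p : ℝ, i ∈ s → ∀ t, ∀ᶠ t' in 𝓝[>] t,
        eulerSign (K i ∩ {x | l x = t}) - eulerSign (K i ∩ {x | l x = t'}) =
          if p = t then eulerSign (K i) else 0 := by
      intro i
      by_cases hi : i ∈ s
      · obtain ⟨p, hp⟩ := (hK i hi).eulerSign_fiber_jump l (himg ▸ image_mono (hsub i hi))
        exact ⟨p, fun _ => hp⟩
      · exact ⟨0, fun h => absurd h hi⟩
    choose p hp using hjump
    have hsum : ∀ t, ∑ i ∈ s with p i = t, eulerSign (K i) = if t = β then 1 else 0 := by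
      intro t
      have h1 : ∀ᶠ t' in 𝓝[>] t, ∀ i ∈ s,
          eulerSign (K i ∩ {x | l x = t}) - eulerSign (K i ∩ {x | l x = t'}) =
          if p i = t then eulerSign (K i) else 0 :=
        (Filter.eventually_all_finset s).2 fun i hi => hp i hi t
      have h2 : ∀ᶠ t' in 𝓝[>] t, (∑ i ∈ s, eulerSign (K i ∩ {x | l x = t})) -
          ∑ i ∈ s, eulerSign (K i ∩ {x | l x = t'}) = if t = β then 1 else 0 := by
        rcases lt_or_ge t α with h | h
        · rw [if_neg (h.trans_le hαβ).ne]
          filter_upwards [Ioo_mem_nhdsGT h] with t' ht'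
          rw [hg0 t fun h' => not_lt_of_ge h'.1 h, hg0 t' fun h' => not_lt_of_ge h'.1 ht'.2,
            sub_zero]
        · rcases lt_trichotomy t β with h' | rfl | h'
          · rw [if_neg h'.ne]
            filter_upwards [Ioo_mem_nhdsGT h'] with t' ht'
            rw [hg1 t ⟨h, h'.le⟩, hg1 t' ⟨h.trans ht'.1.le, ht'.2.le⟩, sub_self]
          · rw [if_pos rfl]
            filter_upwards [self_mem_nhdsWithin] with t' ht'
            rw [hg1 t ⟨h, le_rfl⟩, hg0 t' fun h' => not_lt_of_ge h'.2 ht', sub_zero]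
          · rw [if_neg h'.ne']
            filter_upwards [self_mem_nhdsWithin] with t' ht'
            have ht'' : t < t' := ht'
            rw [hg0 t fun h'' => not_lt_of_ge h''.2 h',
              hg0 t' fun h'' => not_lt_of_ge h''.2 (h'.trans ht''), sub_zero]
      obtain ⟨t', h1, h2⟩ := (h1.and h2).exists
      rw [← h2, ← Finset.sum_sub_distrib, Finset.sum_filter]
      exact Finset.sum_congr rfl fun i hi => (h1 i hi).symm
    -- Group the pieces by the location of their jump; `β` is inserted so that the one non-zero
    -- group is certainly indexed.
    rw [← Finset.sum_fiberwise_of_maps_to (t := insert β (s.image p)) (g := p)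
      fun i hi => Finset.mem_insert_of_mem (Finset.mem_image_of_mem p hi)]
    simp only [hsum]
    simp

end Valuation

/-! ### Sections of projections of compact convex sets -/

section Sliceable

variable {E : Type*} [NormedAddCommGroup E] [NormedSpace ℝ E] [FiniteDimensional ℝ E]

/-- `X` need not be convex or closed: it takes the same joint values of the functionals as `Q`, so
its images are compact intervals because those of `Q` are. Once all functionals are fixed, at most
one point remains. -/
theorem eulerSliceable_of_list (L : List (E →ₗ[ℝ] ℝ)) {Q X : Set E} (hXQ : X ⊆ Q)
    (hQ : Convex ℝ Q) (hQc : IsCompact Q) (hsurj : ∀ x ∈ Q, ∃ y ∈ X, ∀ l ∈ L, l y = l x)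
    (hinj : ∀ x ∈ X, ∀ y ∈ X, (∀ l ∈ L, l x = l y) → x = y) : EulerSliceable X := by
  induction L generalizing Q X with
  | nil => exact .subsingleton fun x hx y hy => hinj x hx y hy (by simp)
  | cons l L ih =>
    rcases Q.eq_empty_or_nonempty with rfl | hne
    · exact .subsingleton (subset_empty_iff.1 hXQ ▸ subsingleton_empty)
    have hl : Continuous l := l.continuous_of_finiteDimensional
    have himg : l '' X = l '' Q := by
      refine Subset.antisymm (image_mono hXQ) ?_
      rintro _ ⟨x, hx, rfl⟩
      obtain ⟨y, hy, h⟩ := hsurj x hx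
      exact ⟨y, hy, h l (by simp)⟩
    refine .slice l (sInf (l '' Q)) (sSup (l '' Q)) ?_ fun t => ?_
    · rw [himg]
      exact eq_Icc_of_connected_compact
        ⟨hne.image l, (hQ.linear_image l).isPreconnected⟩ (hQc.image hl)
    · refine ih (Q := Q ∩ {x | l x = t}) (inter_subset_inter_left _ hXQ)
        (hQ.inter ((convex_singleton t).linear_preimage l))
        (hQc.inter_right (isClosed_singleton.preimage hl)) ?_ ?_
      · rintro x ⟨hx, hxt⟩
        obtain ⟨y, hy, h⟩ := hsurj x hx
        exact ⟨y, ⟨hy, (h l (by simp)).trans hxt⟩, fun m hm => h m (by simp [hm])⟩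
      · rintro x ⟨hx, hxt⟩ y ⟨hy, hyt⟩ h
        refine hinj x hx y hy ?_
        simp only [List.mem_cons, forall_eq_or_imp]
        exact ⟨hxt.trans (Eq.symm hyt), h⟩

theorem exists_list_functionals (W : Submodule ℝ E) :
    ∃ L : List (E →ₗ[ℝ] ℝ), ∀ x, (∀ l ∈ L, l x = 0) ↔ x ∈ W := by
  let b := Module.finBasis ℝ (E ⧸ W)
  refine ⟨List.ofFn fun i => (b.coord i).comp W.mkQ, fun x => ?_⟩
  simp only [List.mem_ofFn, forall_exists_index, forall_apply_eq_imp_iff]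
  rw [← Submodule.Quotient.mk_eq_zero, ← b.forall_coord_eq_zero_iff]
  rfl

theorem eulerSliceable_of_projection (W : Submodule ℝ E) {Q X : Set E} (hXQ : X ⊆ Q)
    (hQ : Convex ℝ Q) (hQc : IsCompact Q) (hsurj : ∀ x ∈ Q, ∃ y ∈ X, y - x ∈ W)
    (hinj : ∀ x ∈ X, ∀ y ∈ X, x - y ∈ W → x = y) : EulerSliceable X := by
  obtain ⟨L, hL⟩ := exists_list_functionals W
  refine eulerSliceable_of_list L hXQ hQ hQc (fun x hx => ?_) fun x hx y hy h => ?_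
  · obtain ⟨y, hy, h⟩ := hsurj x hx
    exact ⟨y, hy, fun l hl => by simpa [sub_eq_zero] using (hL _).2 h l hl⟩
  · exact hinj x hx y hy ((hL _).1 fun l hl => by simp [h l hl])

end Sliceable

/-! ### Farkas' lemma and supporting functionals -/

section Farkas

variable {E : Type*} [NormedAddCommGroup E] [InnerProductSpace ℝ E]

/-- Induction on the generators. If `v j` is really needed, some `x` has `⟪x, v i⟫ ≤ 0` for the
others but `⟪x, d⟫ > 0`, which forces `⟪x, v j⟫ > 0`. Projecting along `v j` onto the orthogonal
complement of `x` removes `v j`, and the signs at `x` make its recovered coefficient non-negative.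
-/
theorem farkas {ι : Type*} (s : Finset ι) (v : ι → E) (d : E)
    (h : ∀ m : E, (∀ i ∈ s, inner ℝ m (v i) ≤ 0) → inner ℝ m d ≤ 0) :
    ∃ c : ι → ℝ, (∀ i ∈ s, 0 ≤ c i) ∧ d = ∑ i ∈ s, c i • v i := by
  classical
  induction s using Finset.induction_on generalizing v d with
  | empty => exact ⟨0, by simp, by simpa using h d (by simp)⟩
  | insert j s hj ih =>
    have hne : ∀ i ∈ s, i ≠ j := fun i hi hij => hj (hij ▸ hi)
    have key : ∀ (c : ι → ℝ) (a : ℝ), (∀ i ∈ s, 0 ≤ c i) → 0 ≤ a →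
        d = a • v j + ∑ i ∈ s, c i • v i →
        ∃ c : ι → ℝ, (∀ i ∈ insert j s, 0 ≤ c i) ∧ d = ∑ i ∈ insert j s, c i • v i := by
      intro c a hc ha hd
      refine ⟨Function.update c j a, ?_, ?_⟩
      · intro i hi
        rcases Finset.mem_insert.1 hi with rfl | hi
        · simpa using ha
        · simpa [hne i hi] using hc i hi
      · rw [Finset.sum_insert hj, Function.update_self, hd]
        congr 1
        exact Finset.sum_congr rfl fun i hi => by rw [Function.update_of_ne (hne i hi)]
    by_cases h' : ∀ m : E, (∀ i ∈ s, inner ℝ m (v i) ≤ 0) → inner ℝ m d ≤ 0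
    · obtain ⟨c, hc, hd⟩ := ih v d h'
      exact key c 0 hc le_rfl (by simpa using hd)
    · push Not at h'
      obtain ⟨x, hx, hxd⟩ := h'
      have hβ : 0 < inner ℝ x (v j) := by
        by_contra hcon
        refine not_le_of_gt hxd (h x fun i hi => ?_)
        rcases Finset.mem_insert.1 hi with rfl | hi
        · exact not_lt.1 hcon
        · exact hx i hi
      set β := inner ℝ x (v j) with hβd
      obtain ⟨c, hc, hd⟩ := ih (fun i => v i - (inner ℝ x (v i) / β) • v j)
        (d - (inner ℝ x d / β) • v j) fun m hm => by
          -- The adjoint of the projection: it replaces `m` by a functional that vanishes on `v j`.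
          have h1 : ∀ z : E, inner ℝ m (z - (inner ℝ x z / β) • v j) =
              inner ℝ (m - (inner ℝ m (v j) / β) • x) z := by
            intro z
            rw [inner_sub_left, inner_sub_right, real_inner_smul_left, real_inner_smul_right]
            ring
          rw [h1]
          refine h _ fun i hi => ?_
          rcases Finset.mem_insert.1 hi with rfl | hi
          · rw [inner_sub_left, real_inner_smul_left, ← hβd, div_mul_cancel₀ _ hβ.ne', sub_self]
          · rw [← h1]
            exact hm i hi
      refine key c (inner ℝ x d / β + ∑ i ∈ s, c i * (-(inner ℝ x (v i) / β))) hc ?_ ?_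
      · refine add_nonneg (by positivity) (Finset.sum_nonneg fun i hi => mul_nonneg (hc i hi) ?_)
        rw [← neg_div]
        exact div_nonneg (neg_nonneg.2 (hx i hi)) hβ.le
      · have e := sub_add_cancel d ((inner ℝ x d / β) • v j)
        rw [hd] at e
        refine e.symm.trans ?_
        simp only [smul_sub, Finset.sum_sub_distrib, smul_smul, add_smul, Finset.sum_smul, mul_neg,
          neg_smul, Finset.sum_neg_distrib]
        abel

/-- Without such an `m`, Farkas' lemma puts `d` in the cone spanned by `S - x`; dividing by the
total weight of the combination moves `x` to a convex combination of `S`. -/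
theorem exists_inner_pos_of_ray {S : Set E} (hS : S.Finite) {x d : E} (hx : x ∈ convexHull ℝ S)
    (hd : ∀ ε : ℝ, 0 < ε → x + ε • d ∉ convexHull ℝ S) :
    ∃ m : E, (∀ y ∈ convexHull ℝ S, inner ℝ m y ≤ inner ℝ m x) ∧ 0 < inner ℝ m d := by
  by_contra! hcon
  obtain ⟨c, hc, hdc⟩ := farkas hS.toFinset (fun y => y - x) d fun m hm => by
    refine hcon m fun y hy => ?_
    have hconv : Convex ℝ {y | inner ℝ m y ≤ inner ℝ m x} :=
      convex_halfSpace_le (innerSL ℝ m).isLinear _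
    refine convexHull_min (fun z hz => ?_) hconv hy
    have := hm z (hS.mem_toFinset.2 hz)
    rw [inner_sub_right] at this
    exact sub_nonpos.1 this
  have hw0 := Finset.sum_nonneg hc
  rcases hw0.eq_or_lt with hw | hw
  · have h0 := (Finset.sum_eq_zero_iff_of_nonneg hc).1 hw.symm
    have : d = 0 := by
      rw [hdc]
      exact Finset.sum_eq_zero fun i hi => by rw [h0 i hi, zero_smul]
    exact hd 1 one_pos (by simpa [this] using hx)
  · set w := ∑ i ∈ hS.toFinset, c i
    refine hd w⁻¹ (inv_pos.2 hw) ?_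
    have h := (convex_convexHull ℝ S).sum_mem (t := hS.toFinset) (w := fun i => w⁻¹ * c i)
      (z := fun i => i) (fun i hi => mul_nonneg (inv_nonneg.2 hw0) (hc i hi))
      (by rw [← Finset.mul_sum, inv_mul_cancel₀ hw.ne'])
      (fun i hi => subset_convexHull ℝ S (hS.mem_toFinset.1 hi))
    convert h using 1
    rw [hdc]
    simp only [smul_sub, Finset.sum_sub_distrib, ← Finset.sum_smul, mul_smul, ← Finset.smul_sum]
    rw [show ∑ i ∈ hS.toFinset, c i = w from rfl, smul_smul, inv_mul_cancel₀ hw.ne']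
    module

end Farkas

theorem relInt_nonempty {E : Type*} [NormedAddCommGroup E] [NormedSpace ℝ E]
    [FiniteDimensional ℝ E] {F : Set E} (hF : Convex ℝ F) (hne : F.Nonempty) :
    (relInt F).Nonempty := by
  obtain ⟨_, x, hx, rfl⟩ := hne.intrinsicInterior hF
  refine ⟨x, interior_subset (s := ((↑) ⁻¹' F : Set (affineSpan ℝ F))) hx, fun y hy => ?_⟩
  let f : ℝ → affineSpan ℝ F := fun t => ⟨AffineMap.lineMap y (x : E) (1 + t),
    AffineMap.lineMap_mem _ (subset_affineSpan ℝ F hy) x.2⟩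
  have hcont : Continuous f :=
    (AffineMap.lineMap_continuous.comp (continuous_const.add continuous_id)).subtype_mk _
  have hf0 : f 0 = x := by simp [f]
  have h0 : ∀ᶠ t in 𝓝 (0 : ℝ), f t ∈ interior ((↑) ⁻¹' F : Set (affineSpan ℝ F)) :=
    hcont.continuousAt.eventually (isOpen_interior.mem_nhds (by rwa [hf0]))
  obtain ⟨ε, h, hε⟩ := ((h0.filter_mono nhdsWithin_le_nhds).and
    (self_mem_nhdsWithin (s := Ioi (0 : ℝ)))).exists
  refine ⟨ε, hε, ?_⟩
  have h1 : AffineMap.lineMap y (x : E) (1 + ε) ∈ F :=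
    interior_subset (s := ((↑) ⁻¹' F : Set (affineSpan ℝ F))) h
  convert h1 using 1
  simp only [AffineMap.lineMap_apply_module]
  module

/-! ### Decomposition into open faces, and the shadow boundary -/

section Faces

variable {E : Type*} [NormedAddCommGroup E] [InnerProductSpace ℝ E]

theorem eq_of_mem_relInt {P F G : Set E} (hF : IsExposed ℝ P F) (hG : IsExposed ℝ P G)
    {x : E} (hxF : x ∈ relInt F) (hxG : x ∈ relInt G) : F = G := by
  have key : ∀ F G : Set E, IsExposed ℝ P F → IsExposed ℝ P G → x ∈ relInt F → x ∈ relInt G →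
      F ⊆ G := by
    intro F G hF hG hxF hxG y hy
    obtain ⟨ε, hε, h⟩ := hxF.2 y hy
    refine hG.isExtreme.2 (hF.subset hy) (hF.subset h) hxG.1 ?_
    refine ⟨ε / (1 + ε), 1 / (1 + ε), by positivity, by positivity, by field_simp; ring, ?_⟩
    match_scalars <;> field_simp
    ring
  exact (key F G hF hG hxF hxG).antisymm (key G F hG hF hxG hxF)

/-- The face sought is the smallest one through `x`, an intersection of finitely many exposed faces.
-/
theorem exists_isExposed_mem_relInt {S : Set E} (hS : S.Finite)
    (hfin : {F : Set E | F.Nonempty ∧ IsExposed ℝ (convexHull ℝ S) F}.Finite) {x : E}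
    (hx : x ∈ convexHull ℝ S) : ∃ F, IsExposed ℝ (convexHull ℝ S) F ∧ x ∈ relInt F := by
  set P := convexHull ℝ S
  have hfx : {F : Set E | x ∈ F ∧ IsExposed ℝ P F}.Finite :=
    hfin.subset fun F hF => ⟨⟨x, hF.1⟩, hF.2⟩
  have hG : IsExposed ℝ P (⋂₀ ↑hfx.toFinset) :=
    IsExposed.sInter ⟨P, hfx.mem_toFinset.2 ⟨hx, IsExposed.refl P⟩⟩
      fun F hF => (hfx.mem_toFinset.1 hF).2
  rw [hfx.coe_toFinset] at hG
  have hxG : x ∈ ⋂₀ {F : Set E | x ∈ F ∧ IsExposed ℝ P F} := fun F hF => hF.1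
  refine ⟨_, hG, hxG, fun y hy => ?_⟩
  have hyP : y ∈ P := hG.subset hy
  -- Otherwise a functional maximal over `P` at `x` would be strictly smaller at `y`, exposing a
  -- face that contains `x` but not `y`.
  obtain ⟨ε, hε, h⟩ : ∃ ε : ℝ, 0 < ε ∧ x + ε • (x - y) ∈ P := by
    by_contra! hcon
    obtain ⟨m, hm, hpos⟩ := exists_inner_pos_of_ray hS hx hcon
    have hy' := hy ((innerSL ℝ m).toExposed P)
      ⟨⟨hx, hm⟩, ContinuousLinearMap.toExposed.isExposed⟩
    have := hy'.2 x hx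
    simp only [innerSL_apply_apply] at this
    rw [inner_sub_right] at hpos
    linarith
  refine ⟨ε, hε, hG.isExtreme.2 h hyP hxG ?_⟩
  refine ⟨1 / (1 + ε), ε / (1 + ε), by positivity, by positivity, by field_simp, ?_⟩
  match_scalars <;> field_simp
  ring

/-- Prolong the segment from `x` through `y` inside `F`; then `y` is a proper mixture of its far end
and `x`, and a move at `x` induces a shorter one at `y`. Hence the directions into `P` are the same
throughout an open face. -/
theorem exists_add_smul_mem_of_relInt {P F : Set E} (hP : Convex ℝ P) (hFP : F ⊆ P) {x y u : E}
    (hx : x ∈ F) (hy : y ∈ relInt F) (h : ∃ ε : ℝ, 0 < ε ∧ x + ε • u ∈ P) :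
    ∃ ε : ℝ, 0 < ε ∧ y + ε • u ∈ P := by
  obtain ⟨ε, hε, h⟩ := h
  obtain ⟨δ, hδ, h'⟩ := hy.2 x hx
  refine ⟨δ / (1 + δ) * ε, by positivity, ?_⟩
  convert hP (hFP h') h (a := 1 / (1 + δ)) (b := δ / (1 + δ)) (by positivity) (by positivity)
    (by field_simp) using 1
  match_scalars <;> field_simp
  ring

/-- The points of `P` from which one cannot move inside `P` in the direction `u`. -/
def shadowBoundary (P : Set E) (u : E) : Set E :=
  {x | x ∈ P ∧ ¬ ∃ ε : ℝ, 0 < ε ∧ x + ε • u ∈ P}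

/-- Take the point of `P` on the line through `x` parallel to `u` that lies furthest along `u`. -/
theorem exists_mem_shadowBoundary {P : Set E} (hPc : IsCompact P) {u : E} (hu : u ≠ 0) {x : E}
    (hx : x ∈ P) : ∃ y ∈ shadowBoundary P u, y - x ∈ Submodule.span ℝ {u} := by
  have hcont : Continuous fun z : E => inner ℝ u z := by fun_prop
  obtain ⟨y, ⟨hyP, hyx⟩, hmax⟩ :=
    (hPc.inter_right ((Submodule.closed_of_finiteDimensional (Submodule.span ℝ {u})).preimage
      (continuous_id.sub (continuous_const (y := x))))).exists_isMaxOn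
      ⟨x, hx, by simp⟩ hcont.continuousOn
  refine ⟨y, ⟨hyP, ?_⟩, hyx⟩
  rintro ⟨ε, hε, h⟩
  have hyx' : y - x ∈ Submodule.span ℝ {u} := hyx
  have h1 := hmax (a := y + ε • u) ⟨h, by
    change y + ε • u - x ∈ Submodule.span ℝ {u}
    rw [add_sub_right_comm]
    exact add_mem hyx' (Submodule.smul_mem _ _ (Submodule.mem_span_singleton_self u))⟩
  have h2 : inner ℝ u (y + ε • u) ≤ inner ℝ u y := h1
  rw [inner_add_right, real_inner_smul_right] at h2
  have := mul_pos hε (real_inner_self_pos.2 hu)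
  linarith

theorem eq_of_mem_shadowBoundary {P : Set E} {u x y : E} (hx : x ∈ shadowBoundary P u)
    (hy : y ∈ shadowBoundary P u) (h : x - y ∈ Submodule.span ℝ {u}) : x = y := by
  obtain ⟨c, hc⟩ := Submodule.mem_span_singleton.1 h
  rcases lt_trichotomy c 0 with h0 | rfl | h0
  · exact absurd ⟨-c, neg_pos.2 h0, by rw [neg_smul, hc]; simpa using hy.1⟩ hx.2
  · rw [zero_smul] at hc
    exact sub_eq_zero.1 hc.symm
  · exact absurd ⟨c, h0, by rw [hc]; simpa using hx.1⟩ hy.2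

theorem eulerSliceable_of_isCompact [FiniteDimensional ℝ E] {P : Set E} (hP : Convex ℝ P) (hPc : IsCompact P) :
    EulerSliceable P :=
  eulerSliceable_of_projection ⊥ Subset.rfl hP hPc (fun x hx => ⟨x, hx, by simp⟩)
    fun x _ y _ h => sub_eq_zero.1 ((Submodule.mem_bot ℝ).1 h)

theorem eulerSliceable_shadowBoundary [FiniteDimensional ℝ E] {P : Set E} (hP : Convex ℝ P) (hPc : IsCompact P) {u : E}
    (hu : u ≠ 0) : EulerSliceable (shadowBoundary P u) :=
  eulerSliceable_of_projection (Submodule.span ℝ {u}) (fun _ hx => hx.1) hP hPc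
    (fun _ hx => exists_mem_shadowBoundary hPc hu hx) fun _ hx _ hy h =>
      eq_of_mem_shadowBoundary hx hy h

end Faces

/-! ### Euler's and Gram's relations -/

section Polytope

variable {n : ℕ} {P : Set (EuclideanSpace ℝ (Fin n))}

/-- The non-empty faces of `P`, of all dimensions, including `P` itself. -/
def allFaces (P : Set (EuclideanSpace ℝ (Fin n))) : Set (Set (EuclideanSpace ℝ (Fin n))) :=
  {F | F.Nonempty ∧ IsExposed ℝ P F}

theorem affDim_le (F : Set (EuclideanSpace ℝ (Fin n))) : affDim F ≤ n := by
  simpa [affDim] using Submodule.finrank_le (vectorSpan ℝ F)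

theorem allFaces_finite (hP : IsConvexPolytope P) : (allFaces P).Finite := by
  refine (Set.finite_iUnion fun k : Fin (n + 1) => faces_finite (k : ℕ) hP).subset fun F hF => ?_
  exact mem_iUnion.2 ⟨⟨affDim F, Nat.lt_succ_of_le (affDim_le F)⟩, hF.1, hF.2, rfl⟩

theorem IsConvexPolytope.convex (hP : IsConvexPolytope P) : Convex ℝ P := by
  obtain ⟨S, _, rfl⟩ := hP
  exact convex_convexHull ℝ S

theorem IsConvexPolytope.isCompact (hP : IsConvexPolytope P) : IsCompact P := by
  obtain ⟨S, hS, rfl⟩ := hP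
  exact hS.isCompact_convexHull (𝕜 := ℝ)

theorem eulerSign_relInt {F : Set (EuclideanSpace ℝ (Fin n))} (hF : Convex ℝ F)
    (hne : F.Nonempty) : eulerSign (relInt F) = (-1) ^ affDim F := by
  have h := relInt_nonempty hF hne
  rw [eulerSign_of_nonempty h, vectorSpan_relInt hF h, affDim]

theorem pairwiseDisjoint_relInt : (allFaces P).PairwiseDisjoint relInt := by
  intro F hF G hG hne
  rw [Function.onFun, disjoint_left]
  exact fun x hxF hxG => hne (eq_of_mem_relInt hF.2 hG.2 hxF hxG)

theorem exists_face_mem_relInt (hP : IsConvexPolytope P) {x : EuclideanSpace ℝ (Fin n)}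
    (hx : x ∈ P) : ∃ F ∈ allFaces P, x ∈ relInt F := by
  have hfin := allFaces_finite hP
  obtain ⟨S, hS, rfl⟩ := hP
  obtain ⟨F, hF, hxF⟩ := exists_isExposed_mem_relInt hS hfin hx
  exact ⟨F, ⟨⟨x, hxF.1⟩, hF⟩, hxF⟩

theorem sum_neg_one_pow_affDim_of_sliceable (hP : IsConvexPolytope P)
    {X : Set (EuclideanSpace ℝ (Fin n))} (hX : EulerSliceable X) (hne : X.Nonempty)
    (s : Finset (Set (EuclideanSpace ℝ (Fin n)))) (hs : ↑s ⊆ allFaces P)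
    (hU : X = ⋃ F ∈ s, relInt F) : ∑ F ∈ s, (-1 : ℤ) ^ affDim F = 1 := by
  have hconv : ∀ F ∈ s, Convex ℝ F := fun F hF => (hs hF).2.convex hP.convex
  refine Eq.trans (Finset.sum_congr rfl fun F hF => ?_) (hX.sum_eulerSign hne s relInt
    (fun F hF => isRelOpen_relInt (hconv F hF)) (pairwiseDisjoint_relInt.subset hs) hU)
  exact (eulerSign_relInt (hconv F hF) (hs hF).1).symm

/-- **Euler's relation** for convex polytopes. -/
theorem sum_neg_one_pow_affDim (hP : IsConvexPolytope P) (hne : P.Nonempty) :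
    ∑ F ∈ (allFaces_finite hP).toFinset, (-1 : ℤ) ^ affDim F = 1 := by
  refine sum_neg_one_pow_affDim_of_sliceable hP (eulerSliceable_of_isCompact hP.convex hP.isCompact)
    hne _ (by simp) (Subset.antisymm (fun x hx => ?_) ?_)
  · obtain ⟨F, hF, hxF⟩ := exists_face_mem_relInt hP hx
    exact mem_iUnion₂.2 ⟨F, (allFaces_finite hP).mem_toFinset.2 hF, hxF⟩
  · exact iUnion₂_subset fun F hF x hx => ((allFaces_finite hP).mem_toFinset.1 hF).2.subset hx.1

open Classical in
/-- The relation behind Gram's relation, for a single direction. -/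
theorem sum_neg_one_pow_affDim_direction (hP : IsConvexPolytope P) (hne : P.Nonempty)
    {c : Set (EuclideanSpace ℝ (Fin n)) → EuclideanSpace ℝ (Fin n)}
    (hc : ∀ F ∈ allFaces P, c F ∈ relInt F) {u : EuclideanSpace ℝ (Fin n)} (hu : u ≠ 0) :
    ∑ F ∈ (allFaces_finite hP).toFinset with ∃ ε : ℝ, 0 < ε ∧ c F + ε • u ∈ P,
      (-1 : ℤ) ^ affDim F = 0 := by
  have h1 := sum_neg_one_pow_affDim hP hne
  rw [← Finset.sum_filter_add_sum_filter_not _ fun F => ∃ ε : ℝ, 0 < ε ∧ c F + ε • u ∈ P] at h1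
  -- The open faces with `u` not pointing into `P` fill the shadow boundary, so their signs already
  -- account for the whole sum 1.
  have h2 : ∑ F ∈ (allFaces_finite hP).toFinset with ¬ ∃ ε : ℝ, 0 < ε ∧ c F + ε • u ∈ P,
      (-1 : ℤ) ^ affDim F = 1 := by
    refine sum_neg_one_pow_affDim_of_sliceable hP
      (eulerSliceable_shadowBoundary hP.convex hP.isCompact hu) ?_ _ ?_ ?_
    · obtain ⟨x, hx⟩ := hne
      obtain ⟨y, hy, _⟩ := exists_mem_shadowBoundary hP.isCompact hu hx
      exact ⟨y, hy⟩
    · intro F hF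
      exact (allFaces_finite hP).mem_toFinset.1 (Finset.mem_filter.1 hF).1
    · ext x
      simp only [Finset.mem_filter, Finite.mem_toFinset, mem_iUnion, exists_prop]
      constructor
      · rintro ⟨hxP, hx⟩
        obtain ⟨F, hF, hxF⟩ := exists_face_mem_relInt hP hxP
        exact ⟨F, ⟨hF, fun h => hx (exists_add_smul_mem_of_relInt hP.convex hF.2.subset
          (hc F hF).1 hxF h)⟩, hxF⟩
      · rintro ⟨F, ⟨hF, h⟩, hxF⟩
        exact ⟨hF.2.subset hxF.1, fun h' => h (exists_add_smul_mem_of_relInt hP.convex hF.2.subset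
          hxF.1 (hc F hF) h')⟩
  linarith

theorem solidAngle_eq_of_mem_relInt (hP : Convex ℝ P) {F : Set (EuclideanSpace ℝ (Fin n))}
    (hF : F ⊆ P) {x y : EuclideanSpace ℝ (Fin n)} (hx : x ∈ relInt F) (hy : y ∈ relInt F) :
    solidAngle P x = solidAngle P y :=
  Subset.antisymm (fun _ => exists_add_smul_mem_of_relInt hP hF hx.1 hy)
    fun _ => exists_add_smul_mem_of_relInt hP hF hy.1 hx

/-- By convexity `ε` may be shrunk to some `1 / (k + 1)`, leaving a countable union of closed sets.
-/
theorem measurableSet_solidAngle (hP : Convex ℝ P) (hPc : IsClosed P)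
    {x : EuclideanSpace ℝ (Fin n)} (hx : x ∈ P) : MeasurableSet (solidAngle P x) := by
  have h : solidAngle P x = ⋃ k : ℕ, {u : Metric.sphere (0 : EuclideanSpace ℝ (Fin n)) 1 |
      x + (1 / ((k : ℝ) + 1)) • (u : EuclideanSpace ℝ (Fin n)) ∈ P} := by
    ext u
    rw [mem_iUnion]
    constructor
    · rintro ⟨ε, hε, h⟩
      obtain ⟨k, hk⟩ := exists_nat_one_div_lt hε
      refine ⟨k, ?_⟩
      have := hP.add_smul_mem hx h (t := 1 / ((k : ℝ) + 1) / ε)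
        ⟨by positivity, (div_le_one hε).2 hk.le⟩
      rwa [smul_smul, div_mul_cancel₀ _ hε.ne'] at this
    · rintro ⟨k, hk⟩
      exact ⟨_, by positivity, hk⟩
  rw [h]
  refine MeasurableSet.iUnion fun k => (hPc.preimage ?_).measurableSet
  fun_prop

/-- **Gram's relation** for convex polytopes. -/
theorem sum_neg_one_pow_mul_angleAt (hP : IsConvexPolytope P) (hne : P.Nonempty)
    {c : Set (EuclideanSpace ℝ (Fin n)) → EuclideanSpace ℝ (Fin n)}
    (hc : ∀ F ∈ allFaces P, c F ∈ relInt F) :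
    ∑ F ∈ (allFaces_finite hP).toFinset, (-1 : ℝ) ^ affDim F * angleAt P (c F) = 0 := by
  classical
  have hmeas : ∀ F ∈ (allFaces_finite hP).toFinset, MeasurableSet (solidAngle P (c F)) := by
    intro F hF
    have hF' := (allFaces_finite hP).mem_toFinset.1 hF
    exact measurableSet_solidAngle hP.convex hP.isCompact.isClosed (hF'.2.subset (hc F hF').1)
  set μ := (volume : Measure (EuclideanSpace ℝ (Fin n))).toSphere
  -- Gram's relation is the integral over the sphere of this pointwise identity.
  have h1 : ∀ u, ∑ F ∈ (allFaces_finite hP).toFinset,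
      (-1 : ℝ) ^ affDim F * (solidAngle P (c F)).indicator 1 u = 0 := by
    intro u
    have hu : (u : EuclideanSpace ℝ (Fin n)) ≠ 0 := by
      intro h
      have := u.2
      rw [h] at this
      simp at this
    have h := sum_neg_one_pow_affDim_direction hP hne hc hu
    have h' := congrArg (Int.cast : ℤ → ℝ) h
    rw [Finset.sum_filter] at h'
    push_cast at h'
    rw [← h']
    refine Finset.sum_congr rfl fun F _ => ?_
    by_cases hFu : u ∈ solidAngle P (c F)
    · rw [indicator_of_mem hFu]; exact (mul_one _).trans (if_pos hFu).symm
    · rw [indicator_of_notMem hFu]; exact (mul_zero _).trans (if_neg hFu).symm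
  have h2 : ∫ u, ∑ F ∈ (allFaces_finite hP).toFinset,
      (-1 : ℝ) ^ affDim F * (solidAngle P (c F)).indicator 1 u ∂μ = 0 := by
    simp only [h1, integral_zero]
  rw [integral_finsetSum] at h2
  · rw [← h2]
    refine Finset.sum_congr rfl fun F hF => ?_
    rw [integral_const_mul, integral_indicator_one (hmeas F hF)]
    rfl
  · intro F hF
    exact ((integrable_const (1 : ℝ)).indicator (hmeas F hF)).const_mul _

/-! ### Surface measure of half-spheres -/

theorem toSphere_pos_eq_toSphere_neg {n : ℕ} (l : StrongDual ℝ (EuclideanSpace ℝ (Fin n))) :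
    (volume : Measure (EuclideanSpace ℝ (Fin n))).toSphere {u | 0 < l u} =
      (volume : Measure (EuclideanSpace ℝ (Fin n))).toSphere {u | l u < 0} := by
  have h1 : MeasurableSet {u : Metric.sphere (0 : EuclideanSpace ℝ (Fin n)) 1 | 0 < l u} :=
    (isOpen_lt (by fun_prop) (by fun_prop)).measurableSet
  have h2 : MeasurableSet {u : Metric.sphere (0 : EuclideanSpace ℝ (Fin n)) 1 | l u < 0} :=
    (isOpen_lt (by fun_prop) (by fun_prop)).measurableSet
  rw [Measure.toSphere_apply' _ h1, Measure.toSphere_apply' _ h2]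
  congr 1
  rw [← Measure.measure_neg]
  congr 1
  ext x
  simp only [Set.mem_neg, Set.mem_smul, Set.mem_image, Set.mem_ofPred_eq]
  constructor
  · rintro ⟨r, hr, _, ⟨u, hu, rfl⟩, h⟩
    exact ⟨r, hr, _, ⟨-u, by simpa using hu, rfl⟩, by
      rw [← neg_neg x, ← h]; simp⟩
  · rintro ⟨r, hr, _, ⟨u, hu, rfl⟩, h⟩
    exact ⟨r, hr, _, ⟨-u, by simpa using hu, rfl⟩, by rw [← h]; simp⟩

theorem toSphere_ker {n : ℕ} {l : StrongDual ℝ (EuclideanSpace ℝ (Fin n))} (hl : l ≠ 0) :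
    (volume : Measure (EuclideanSpace ℝ (Fin n))).toSphere {u | l u = 0} = 0 := by
  have h1 : MeasurableSet {u : Metric.sphere (0 : EuclideanSpace ℝ (Fin n)) 1 | l u = 0} :=
    (isClosed_eq (by fun_prop) (by fun_prop)).measurableSet
  rw [Measure.toSphere_apply' _ h1]
  have h0 : volume (LinearMap.ker (l : EuclideanSpace ℝ (Fin n) →ₗ[ℝ] ℝ) :
      Set (EuclideanSpace ℝ (Fin n))) = 0 := by
    refine Measure.addHaar_submodule _ _ fun h => hl ?_
    ext x
    have : x ∈ LinearMap.ker (l : EuclideanSpace ℝ (Fin n) →ₗ[ℝ] ℝ) := h ▸ Submodule.mem_top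
    simpa using this
  rw [measure_mono_null ?_ h0, mul_zero]
  rintro _ ⟨r, _, _, ⟨u, hu, rfl⟩, rfl⟩
  have hu' : l u = 0 := hu
  simp [hu']

theorem toSphere_real_univ_three :
    (volume : Measure (EuclideanSpace ℝ (Fin 3))).toSphere.real univ = 4 * Real.pi := by
  rw [Measure.toSphere_real_apply_univ, Measure.real, EuclideanSpace.volume_ball_fin_three]
  simp
  rw [ENNReal.toReal_ofReal (by positivity)]
  ring

theorem toSphere_real_halfSphere {l : StrongDual ℝ (EuclideanSpace ℝ (Fin 3))} (hl : l ≠ 0) :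
    (volume : Measure (EuclideanSpace ℝ (Fin 3))).toSphere.real {u | l u < 0} = 2 * Real.pi := by
  set μ := (volume : Measure (EuclideanSpace ℝ (Fin 3))).toSphere with hμ
  have h2 : MeasurableSet {u : Metric.sphere (0 : EuclideanSpace ℝ (Fin 3)) 1 | l u < 0} :=
    (isOpen_lt (by fun_prop) (by fun_prop)).measurableSet
  have h3 := measureReal_add_measureReal_compl (μ := μ) h2
  rw [toSphere_real_univ_three] at h3
  have h4 : μ.real {u : Metric.sphere (0 : EuclideanSpace ℝ (Fin 3)) 1 | l u < 0}ᶜ =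
      μ.real {u | l u < 0} := by
    rw [Measure.real, Measure.real, ← toSphere_pos_eq_toSphere_neg l]
    congr 1
    refine measure_congr ?_
    have h0 : ∀ᵐ u : Metric.sphere (0 : EuclideanSpace ℝ (Fin 3)) 1 ∂μ, ¬ l u = 0 := by
      rw [ae_iff]; simpa using toSphere_ker hl
    filter_upwards [h0] with u hu
    apply propext
    change ¬ (l u < 0) ↔ 0 < l u
    rw [not_lt]
    exact ⟨fun h => lt_of_le_of_ne h (Ne.symm hu), le_of_lt⟩
  linarith

theorem toSphere_real_of_halfSpace {l : StrongDual ℝ (EuclideanSpace ℝ (Fin 3))} (hl : l ≠ 0)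
    {A : Set (Metric.sphere (0 : EuclideanSpace ℝ (Fin 3)) 1)}
    (h1 : ∀ u : Metric.sphere (0 : EuclideanSpace ℝ (Fin 3)) 1, l u < 0 → u ∈ A)
    (h2 : ∀ u ∈ A, l u ≤ 0) :
    (volume : Measure (EuclideanSpace ℝ (Fin 3))).toSphere.real A = 2 * Real.pi := by
  rw [← toSphere_real_halfSphere hl, Measure.real, Measure.real]
  congr 1
  refine measure_congr ?_
  have h0 : ∀ᵐ u : Metric.sphere (0 : EuclideanSpace ℝ (Fin 3)) 1
      ∂(volume : Measure (EuclideanSpace ℝ (Fin 3))).toSphere, ¬ l u = 0 := by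
    rw [ae_iff]; simpa using toSphere_ker hl
  filter_upwards [h0] with u hu
  apply propext
  exact ⟨fun h => lt_of_le_of_ne (h2 u h) hu, fun h => h1 u h⟩

end Polytope

/-! ### Edges and their centroids -/

section Segment

variable {n : ℕ}

theorem exists_eq_segment {F : Set (EuclideanSpace ℝ (Fin n))} (hF : Convex ℝ F)
    (hFc : IsCompact F) (hdim : affDim F = 1) : ∃ a b, a ≠ b ∧ F = segment ℝ a b := by
  have hnF : F.Nontrivial := by
    by_contra h
    rw [not_nontrivial_iff] at h
    rw [affDim, vectorSpan_of_subsingleton ℝ h, finrank_bot] at hdim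
    exact zero_ne_one hdim
  obtain ⟨v, -, hv⟩ := finrank_eq_one_iff'.1 hdim
  have hspan : ∀ x ∈ F, ∀ y ∈ F, ∃ r : ℝ, y - x = r • (v : EuclideanSpace ℝ (Fin n)) := by
    intro x hx y hy
    obtain ⟨r, hr⟩ := hv ⟨_, vsub_mem_vectorSpan ℝ hy hx⟩
    exact ⟨r, (congrArg Subtype.val hr).symm⟩
  have hcont : Continuous fun z : EuclideanSpace ℝ (Fin n) =>
    inner ℝ (v : EuclideanSpace ℝ (Fin n)) z := by fun_prop
  obtain ⟨a, ha, hmin⟩ := hFc.exists_isMinOn hnF.nonempty hcont.continuousOn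
  obtain ⟨b, hb, hmax⟩ := hFc.exists_isMaxOn hnF.nonempty hcont.continuousOn
  have hFs : F = segment ℝ a b := by
    refine Subset.antisymm (fun y hy => ?_) (hF.segment_subset ha hb)
    obtain ⟨s, hs⟩ := hspan a ha y hy
    obtain ⟨r, hr⟩ := hspan a ha b hb
    rw [segment_eq_image']
    by_cases hv0 : (v : EuclideanSpace ℝ (Fin n)) = 0
    · exact ⟨0, by simp, by simpa [hv0, sub_eq_zero, eq_comm] using hs⟩
    have hvv := real_inner_self_pos.2 hv0
    have h1 : inner ℝ (v : EuclideanSpace ℝ (Fin n)) a ≤ inner ℝ (v : EuclideanSpace ℝ (Fin n)) y :=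
      hmin hy
    have h2 : inner ℝ (v : EuclideanSpace ℝ (Fin n)) y ≤ inner ℝ (v : EuclideanSpace ℝ (Fin n)) b :=
      hmax hy
    have ey := eq_add_of_sub_eq hs
    have eb := eq_add_of_sub_eq hr
    rw [ey, inner_add_right, real_inner_smul_right] at h1 h2
    rw [eb, inner_add_right, real_inner_smul_right] at h2
    have hs0 : 0 ≤ s := by by_contra! h; nlinarith
    have hsr : s ≤ r := by by_contra! h; nlinarith
    rcases hs0.eq_or_lt with rfl | hs0
    · exact ⟨0, by simp, by simp [ey]⟩
    · refine ⟨s / r, ⟨div_nonneg hs0.le (hs0.le.trans hsr), (div_le_one (hs0.trans_le hsr)).2 hsr⟩, ?_⟩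
      change a + (s / r) • (b - a) = y
      rw [hr, smul_smul, div_mul_cancel₀ _ (hs0.trans_le hsr).ne', ey, add_comm]
  refine ⟨a, b, fun h => ?_, hFs⟩
  rw [hFs, h, segment_same] at hnF
  exact not_nontrivial_singleton hnF

/-- The reflection `x ↦ a + b - x` is an isometry preserving the segment, so the integral `I` of the
identity satisfies `I = μ(F) (a + b) - I`, and the length `μ(F)` is finite and non-zero. -/
theorem centroid_eq_midpoint {a b : EuclideanSpace ℝ (Fin n)} (hab : a ≠ b)
    (hdim : affDim (segment ℝ a b) = 1) : centroid (segment ℝ a b) = midpoint ℝ a b := by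
  rw [centroid, hdim, Nat.cast_one]
  set F := segment ℝ a b
  set μ : Measure (EuclideanSpace ℝ (Fin n)) := Measure.hausdorffMeasure 1
  have hμF : μ F = edist a b := hausdorffMeasure_segment a b
  have hFc : IsCompact F := by
    rw [show F = convexHull ℝ {a, b} from (convexHull_pair a b).symm]
    exact (Set.toFinite _).isCompact_convexHull (𝕜 := ℝ)
  have hfin : μ F ≠ ⊤ := by rw [hμF]; exact edist_ne_top a b
  have hpos : μ.real F ≠ 0 := by
    rw [Measure.real, hμF, ← dist_edist]
    exact dist_ne_zero.2 hab
  have hint : IntegrableOn (fun x => x) F μ := by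
    obtain ⟨C, hC⟩ := hFc.isBounded.exists_norm_le
    exact Measure.integrableOn_of_bounded (M := C) hfin aestronglyMeasurable_id
      ((ae_restrict_iff' hFc.measurableSet).2 (ae_of_all _ hC))
  let T : EuclideanSpace ℝ (Fin n) ≃ᵢ EuclideanSpace ℝ (Fin n) := IsometryEquiv.subLeft (a + b)
  have hT : T ⁻¹' F = F := by
    ext x
    have key : ∀ x ∈ F, a + b - x ∈ F := by
      rintro _ ⟨s, t, hs, ht, hst, rfl⟩
      refine ⟨t, s, ht, hs, by linarith, ?_⟩
      rw [← eq_sub_iff_add_eq] at hst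
      subst hst
      module
    exact ⟨fun h => by simpa [T] using key _ h, key x⟩
  have h1 := (T.measurePreserving_hausdorffMeasure 1).setIntegral_preimage_emb
    T.toHomeomorph.measurableEmbedding (fun x => x) F
  rw [hT] at h1
  have h2 : ∫ x in F, (a + b - x) ∂μ = ∫ x in F, x ∂μ := h1
  rw [integral_sub (integrable_const_iff.2 (Or.inr (by
    rw [isFiniteMeasure_restrict]; exact hfin))) hint, setIntegral_const] at h2
  rw [setAverage_eq]
  have h3 : ∫ x in F, x ∂μ = (1 / 2 : ℝ) • μ.real F • (a + b) := by
    rw [sub_eq_iff_eq_add] at h2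
    rw [h2]; module
  rw [h3, midpoint_eq_smul_add, invOf_eq_inv]
  match_scalars <;> field_simp

theorem midpoint_mem_relInt_segment (a b : EuclideanSpace ℝ (Fin n)) :
    midpoint ℝ a b ∈ relInt (segment ℝ a b) := by
  refine ⟨midpoint_mem_segment a b, ?_⟩
  rintro _ ⟨s, t, hs, ht, hst, rfl⟩
  refine ⟨1, one_pos, t, s, ht, hs, by linarith, ?_⟩
  rw [← eq_sub_iff_add_eq] at hst
  subst hst
  rw [midpoint_eq_smul_add, invOf_eq_inv]
  module

theorem centroid_mem_relInt {P F : Set (EuclideanSpace ℝ (Fin n))} (hP : IsConvexPolytope P)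
    (hF : F ∈ faces 1 P) : centroid F ∈ relInt F := by
  obtain ⟨a, b, hab, rfl⟩ := exists_eq_segment (hF.2.1.convex hP.convex)
    (hF.2.1.isCompact hP.isCompact) hF.2.2
  rw [centroid_eq_midpoint hab hF.2.2]
  exact midpoint_mem_relInt_segment a b

end Segment

/-! ### Dimension three -/

section Three

variable {P : Set (EuclideanSpace ℝ (Fin 3))}

theorem vectorSpan_eq_top_of_interior (hP : Convex ℝ P) (hdim : (interior P).Nonempty) :
    vectorSpan ℝ P = ⊤ :=
  AffineSubspace.vectorSpan_eq_top_of_affineSpan_eq_top ℝ _ _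
    (hP.interior_nonempty_iff_affineSpan_eq_top.1 hdim)

theorem affDim_eq_three (hP : Convex ℝ P) (hdim : (interior P).Nonempty) : affDim P = 3 := by
  rw [affDim, vectorSpan_eq_top_of_interior hP hdim, finrank_top]
  simp

theorem vectorSpan_le_ker {P F : Set (EuclideanSpace ℝ (Fin 3))}
    {l : StrongDual ℝ (EuclideanSpace ℝ (Fin 3))} (hF : F = {y ∈ P | ∀ z ∈ P, l z ≤ l y}) :
    vectorSpan ℝ F ≤ LinearMap.ker (l : EuclideanSpace ℝ (Fin 3) →ₗ[ℝ] ℝ) := by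
  rw [vectorSpan, Submodule.span_le]
  rintro _ ⟨x, hx, y, hy, rfl⟩
  rw [hF] at hx hy
  have := le_antisymm (hx.2 y hy.1) (hy.2 x hx.1)
  simp [this]

theorem faces_three (hP : Convex ℝ P) (hdim : (interior P).Nonempty) : faces 3 P = {P} := by
  ext F
  rw [mem_singleton_iff]
  constructor
  · rintro ⟨hne, hF, hd⟩
    obtain ⟨l, hl⟩ := hF hne
    have htop : vectorSpan ℝ F = ⊤ := Submodule.eq_top_of_finrank_eq (by rw [← affDim, hd]; simp)
    have hl0 : ∀ x, l x = 0 := fun x => by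
      have : x ∈ LinearMap.ker (l : EuclideanSpace ℝ (Fin 3) →ₗ[ℝ] ℝ) :=
        vectorSpan_le_ker hl (htop ▸ Submodule.mem_top)
      simpa using this
    rw [hl]
    simp [hl0]
  · rintro rfl
    exact ⟨hdim.mono interior_subset, IsExposed.refl F, affDim_eq_three hP hdim⟩

theorem angleAt_eq_of_mem_relInt_self (hP : Convex ℝ P) (hdim : (interior P).Nonempty)
    {x : EuclideanSpace ℝ (Fin 3)} (hx : x ∈ relInt P) : angleAt P x = 4 * Real.pi := by
  have h : solidAngle P x = univ := eq_univ_of_forall fun u =>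
    exists_add_smul_mem hP hx (vectorSpan_eq_top_of_interior hP hdim ▸ Submodule.mem_top)
  rw [angleAt, h, toSphere_real_univ_three]

/-- The directions of the facet fill the kernel of its exposing functional `l`, so the solid angle
lies between the open half-sphere `l < 0` and the closed one, which differ by a null set. -/
theorem angleAt_eq_of_mem_relInt_facet (hP : Convex ℝ P) (hdim : (interior P).Nonempty)
    {F : Set (EuclideanSpace ℝ (Fin 3))} (hF : F ∈ faces 2 P) {x : EuclideanSpace ℝ (Fin 3)}
    (hx : x ∈ relInt F) : angleAt P x = 2 * Real.pi := by
  obtain ⟨hne, hexp, hd⟩ := hF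
  have hFP : F ≠ P := by
    rintro rfl
    rw [affDim_eq_three hP hdim] at hd
    omega
  obtain ⟨l, hl⟩ := hexp hne
  have hxF : x ∈ {y ∈ P | ∀ z ∈ P, l z ≤ l y} := hl ▸ hx.1
  have hl0 : l ≠ 0 := by
    rintro rfl
    exact hFP (by rw [hl]; simp)
  have hspan : vectorSpan ℝ F = LinearMap.ker (l : EuclideanSpace ℝ (Fin 3) →ₗ[ℝ] ℝ) := by
    refine Submodule.eq_of_le_of_finrank_eq (vectorSpan_le_ker hl) ?_
    have h1 := Module.Dual.finrank_ker_add_one_of_ne_zero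
      (f := (l : EuclideanSpace ℝ (Fin 3) →ₗ[ℝ] ℝ)) fun h => hl0 (by
        ext z; simpa using LinearMap.congr_fun h z)
    rw [← affDim, hd]
    simp only [finrank_euclideanSpace, Fintype.card_fin] at h1
    omega
  obtain ⟨p, hp, hpx⟩ : ∃ p ∈ P, l p < l x := by
    by_contra! h
    exact hFP (hexp.subset.antisymm fun y hy => by
      rw [hl]; exact ⟨hy, fun z hz => (hxF.2 z hz).trans (h y hy)⟩)
  refine toSphere_real_of_halfSpace hl0 (fun u hu => ?_) ?_
  · have hw : l (p - x) < 0 := by rw [map_sub]; linarith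
    -- This `c` makes `u - c • (p - x)` tangent to the facet; a tangent move combined with a move
    -- towards `p` is a move along `u`.
    set c := l u / l (p - x) with hc
    have hc0 : 0 < c := div_pos_of_neg_of_neg hu hw
    have hf : (u : EuclideanSpace ℝ (Fin 3)) - c • (p - x) ∈ vectorSpan ℝ F := by
      rw [hspan]
      change l _ = 0
      rw [map_sub, map_smul, smul_eq_mul, hc, div_mul_cancel₀ _ hw.ne, sub_self]
    obtain ⟨ε, hε, h⟩ := exists_add_smul_mem (hexp.convex hP) hx hf
    refine ⟨ε / (1 + ε * c), by positivity, ?_⟩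
    convert hP (hexp.subset h) hp (a := 1 / (1 + ε * c)) (b := ε * c / (1 + ε * c))
      (by positivity) (by positivity) (by field_simp) using 1
    match_scalars <;> field_simp
    ring
  · rintro u ⟨ε, hε, h⟩
    have := hxF.2 _ h
    rw [map_add, map_smul, smul_eq_mul] at this
    by_contra! hcon
    have := mul_pos hε hcon
    linarith

theorem sum_allFaces_three (hP : IsConvexPolytope P) (hdim : (interior P).Nonempty)
    (g : Set (EuclideanSpace ℝ (Fin 3)) → ℝ) :
    ∑ F ∈ (allFaces_finite hP).toFinset, (-1 : ℝ) ^ affDim F * g F =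
      ∑ F ∈ (faces_finite 0 hP).toFinset, g F - ∑ F ∈ (faces_finite 1 hP).toFinset, g F +
        ∑ F ∈ (faces_finite 2 hP).toFinset, g F - g P := by
  classical
  have hfib : ∀ k, ∑ F ∈ (allFaces_finite hP).toFinset with affDim F = k,
      (-1 : ℝ) ^ affDim F * g F = (-1) ^ k * ∑ F ∈ (faces_finite k hP).toFinset, g F := by
    intro k
    rw [Finset.mul_sum]
    refine Finset.sum_congr ?_ fun F hF => ?_
    · ext F
      simp [allFaces, faces, and_assoc]
    · rw [((faces_finite k hP).mem_toFinset.1 hF).2.2]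
  have h3 : (faces_finite 3 hP).toFinset = {P} := by
    ext F
    simp [faces_three hP.convex hdim]
  rw [← Finset.sum_fiberwise_of_maps_to (t := Finset.range 4) (g := affDim)
    fun F _ => Finset.mem_range.2 (Nat.lt_succ_of_le (affDim_le F))]
  simp only [hfib, Finset.sum_range_succ, Finset.sum_range_zero, h3, Finset.sum_singleton]
  ring

theorem sum_faceCount (hP : IsConvexPolytope P) (hdim : (interior P).Nonempty) :
    (faceCount 0 P : ℝ) - faceCount 1 P + faceCount 2 P = 2 := by
  have h1 := congrArg (Int.cast : ℤ → ℝ)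
    (sum_neg_one_pow_affDim hP (hdim.mono interior_subset))
  push_cast at h1
  have h2 := sum_allFaces_three hP hdim fun _ => 1
  simp only [mul_one, Finset.sum_const, nsmul_eq_mul] at h2
  rw [h1] at h2
  simp only [faceCount, ncard_eq_toFinset_card _ (faces_finite _ hP)]
  linarith

theorem finsum_vertices_angleAt (hP : IsConvexPolytope P)
    {c : Set (EuclideanSpace ℝ (Fin 3)) → EuclideanSpace ℝ (Fin 3)}
    (hc : ∀ F ∈ allFaces P, c F ∈ relInt F) :
    ∑ᶠ v ∈ vertices P, angleAt P v = ∑ F ∈ (faces_finite 0 hP).toFinset, angleAt P (c F) := by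
  rw [← finsum_mem_eq_finite_toFinset_sum]
  refine finsum_mem_eq_of_bijOn (fun v => {v})
    ⟨fun v hv => hv, singleton_injective.injOn, fun F hF => ?_⟩ fun v hv => ?_
  · obtain ⟨v, hv⟩ := hF.1
    have hsub : F.Subsingleton :=
      (vectorSpan_eq_bot_iff_subsingleton ℝ).1 (Submodule.finrank_eq_zero.1 hF.2.2)
    have hFv := hsub.eq_singleton_of_mem hv
    exact ⟨v, show {v} ∈ faces 0 P from hFv ▸ hF, hFv.symm⟩
  · have hv' : {v} ∈ faces 0 P := hv
    have : c {v} = v := (hc {v} ⟨hv'.1, hv'.2.1⟩).1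
    rw [this]

/-- The vertex and edge angle sums of a polytope, computed from Gram's and Euler's relations. -/
theorem sum_angleAt_sub_sum_faceAngle (hP : IsConvexPolytope P) (hdim : (interior P).Nonempty) :
    (∑ᶠ v ∈ vertices P, angleAt P v) - ∑ᶠ e ∈ faces 1 P, faceAngle P e =
      2 * Real.pi * ((faceCount 0 P : ℝ) - faceCount 1 P) := by
  have hne : P.Nonempty := hdim.mono interior_subset
  have heuler := sum_faceCount hP hdim
  have hex : ∀ F, ∃ x, F ∈ allFaces P → x ∈ relInt F := fun F => by
    by_cases hF : F ∈ allFaces P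
    · obtain ⟨x, hx⟩ := relInt_nonempty (hF.2.convex hP.convex) hF.1
      exact ⟨x, fun _ => hx⟩
    · exact ⟨0, fun h => absurd h hF⟩
  choose c hc using hex
  have hfacets : ∑ F ∈ (faces_finite 2 hP).toFinset, angleAt P (c F) =
      faceCount 2 P * (2 * Real.pi) := by
    rw [faceCount, ncard_eq_toFinset_card _ (faces_finite 2 hP), ← nsmul_eq_mul,
      ← Finset.sum_const]
    refine Finset.sum_congr rfl fun F hF => ?_
    have hF' := (faces_finite 2 hP).mem_toFinset.1 hF
    exact angleAt_eq_of_mem_relInt_facet hP.convex hdim hF' (hc F ⟨hF'.1, hF'.2.1⟩)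
  have hedges : ∑ᶠ e ∈ faces 1 P, faceAngle P e =
      ∑ F ∈ (faces_finite 1 hP).toFinset, angleAt P (c F) := by
    rw [finsum_mem_eq_finite_toFinset_sum _ (faces_finite 1 hP)]
    refine Finset.sum_congr rfl fun F hF => ?_
    have hF' := (faces_finite 1 hP).mem_toFinset.1 hF
    rw [faceAngle, angleAt, angleAt, solidAngle_eq_of_mem_relInt hP.convex hF'.2.1.subset
      (centroid_mem_relInt hP hF') (hc F ⟨hF'.1, hF'.2.1⟩)]
  have hgram := sum_neg_one_pow_mul_angleAt hP hne hc
  rw [sum_allFaces_three hP hdim fun F => angleAt P (c F),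
    angleAt_eq_of_mem_relInt_self hP.convex hdim (hc P ⟨hne, IsExposed.refl P⟩), hfacets] at hgram
  rw [finsum_vertices_angleAt hP hc, hedges]
  -- Gram's relation now gives vertex sum minus edge sum as `4π - 2π f₂`; Euler's relation replaces
  -- `2 - f₂` by `f₀ - f₁`.
  linear_combination hgram - 2 * Real.pi * heuler

end Three

end PolytopeAngle

theorem mainTheorem3 (P : Set (EuclideanSpace ℝ (Fin 3)))
    (hP : PolytopeAngle.IsConvexPolytope P) (hdim : (interior P).Nonempty) :
    1 / (2 * Real.pi) * (∑ᶠ v ∈ PolytopeAngle.vertices P, PolytopeAngle.angleAt P v)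
        - 1 / (2 * Real.pi) *
          (∑ᶠ e ∈ PolytopeAngle.faces 1 P, PolytopeAngle.faceAngle P e)
      = (PolytopeAngle.faceCount 0 P : ℝ) - (PolytopeAngle.faceCount 1 P : ℝ) ∧
    (PolytopeAngle.faceCount 0 P : ℝ) - (PolytopeAngle.faceCount 1 P : ℝ)
      = 2 - (PolytopeAngle.faceCount 2 P : ℝ) := by
  refine ⟨?_, by linarith [PolytopeAngle.sum_faceCount hP hdim]⟩
  rw [← mul_sub, PolytopeAngle.sum_angleAt_sub_sum_faceAngle hP hdim, one_div,
    inv_mul_cancel_left₀ (mul_ne_zero two_ne_zero Real.pi_ne_zero)]
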